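/- For each $n$ let $q_n$ be a prime power (for example $q_n=q$ fixed); write $q=q_n$. For $p\in(0,1)$ put $h_q(p)=(1-p)\log_q\frac1{1-p}+p\log_q\frac{q-1}{p}$. The rate of a code $C\subseteq\mathbb F_q^n$ is $\log_q|C|/n$, $d$ denotes Hamming distance, and $d_{\min}(C)=\min_{c\ne c'\in C}d(c,c')$ (with $d_{\min}=\infty$ if $|C|=1$). For $s\in[0,1]$, $z\sim s$ denotes a random $z\in\mathbb F_q^n$ with independent entries, each equal to $0$ with probability $1-s$ and to each nonzero symbol with probability $\frac{s}{q-1}$. For real $r$ and an integer $\ell\ge 1$, a code $C\subseteq\mathbb F_q^n$ is $(r,\ell)$-list-decodable if $|\{c\in C: d(w,c)\le rn\}|\le \ell$ for all $w\in\mathbb F_q^n$. Fix $p\in(0,1)$ and let $C_n\subseteq\mathbb F_{q}^n$ $(n\in\mathbb N)$ be linear codes whose rates satisfy $\mathrm{rate}(C_n)=1-h_{q}(p)+o(1)$. Suppose that $(C_n)$ achieves list-decoding capacity: for every $L:\mathbb N\to\{1,2,\dots\}$ with $L(n)\to\infty$ there is $\epsilon(n)\to0$ such that every $C_n$ is $(p-\epsilon(n),L(n))$-list-decodable.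 Suppose also that $d_{\min}(C_n)=\omega\big(\frac{q^3}{(1-p)^2}\big)$, i.e. $d_{\min}(C_n)\cdot\frac{(1-p)^2}{q^3}\to\infty$ as $n\to\infty$. Then $(C_n)$ achieves capacity on the $q$-ary symmetric channel qSC$_p$: there are $\epsilon(n)\in[0,p]$ with $\epsilon(n)\to0$ such that for every $n$ there is a randomized decoder $D$ (a random function $\mathbb F_q^n\to C_n$, independent of the noise) with $$\Pr_{D,\;z\sim p-\epsilon(n)}\big[D(c+z)=c\big]\ge 1-\epsilon(n)\qquad\text{for all }c\in C_n .$$ -/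

import Mathlib

open Filter Topology
open scoped ENNReal

noncomputable section

namespace CapacityBridge

/-- The rate `log_q |C| / n` of a code `C ⊆ F^n`, `q = |F|`. -/
def rate {F : Type*} [Fintype F] {n : ℕ} (C : Set (Fin n → F)) : ℝ :=
  Real.logb (Fintype.card F) (C.ncard : ℝ) / n

/-- The `q`-ary entropy `h_q(p) = (1-p) log_q (1/(1-p)) + p log_q ((q-1)/p)`. -/
def qEntropy (q : ℕ) (p : ℝ) : ℝ :=
  (1 - p) * Real.logb q (1 / (1 - p)) + p * Real.logb q (((q : ℝ) - 1) / p)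

/-- The minimum Hamming distance between distinct codewords. As a minimum over the empty set, it is
`⊤` for a code with at most one codeword. -/
def minDist {F : Type*} [DecidableEq F] {n : ℕ} (C : Set (Fin n → F)) : ℕ∞ :=
  ⨅ c ∈ C, ⨅ c' ∈ C, ⨅ _ : c ≠ c', (hammingDist c c' : ℕ∞)

/-- `C` is `(p, L)`-list-decodable: each Hamming ball of radius `p n` contains at most `L`
codewords. -/
def IsListDecodable {F : Type*} [DecidableEq F] {n : ℕ} (C : Set (Fin n → F)) (p : ℝ) (L : ℕ) :
    Prop :=
  ∀ w : Fin n → F, {c ∈ C | (hammingDist w c : ℝ) ≤ p * n}.ncard ≤ L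

/-- The probability of the error string `z` under `p`-noise (for `0 ≤ p ≤ 1`): the entries are
independent, each one being `0` with probability `1 - p` and each nonzero symbol with probability
`p / (q - 1)`. -/
def noiseProb {F : Type*} [Field F] [Fintype F] [DecidableEq F] {n : ℕ} (p : ℝ)
    (z : Fin n → F) : ℝ :=
  ∏ i, if z i = 0 then 1 - p else p / ((Fintype.card F : ℝ) - 1)

theorem noiseProb_nonneg {F : Type*} [Field F] [Fintype F] [DecidableEq F] {n : ℕ} {p : ℝ}
    (h0 : 0 ≤ p) (h1 : p ≤ 1) (z : Fin n → F) : 0 ≤ noiseProb p z := by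
  have hq : (1 : ℝ) < Fintype.card F := by exact_mod_cast Fintype.one_lt_card
  refine Finset.prod_nonneg fun i _ => ?_
  split_ifs
  · linarith
  · exact div_nonneg h0 (by linarith)

theorem sum_noiseProb {F : Type*} [Field F] [Fintype F] [DecidableEq F] {n : ℕ} (p : ℝ) :
    ∑ z : Fin n → F, noiseProb p z = 1 := by
  have hq : (1 : ℝ) < Fintype.card F := by exact_mod_cast Fintype.one_lt_card
  have key : ∑ a : F, (if a = 0 then 1 - p else p / ((Fintype.card F : ℝ) - 1)) = 1 := by
    rw [← Finset.add_sum_erase _ _ (Finset.mem_univ (0 : F)),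
      Finset.sum_congr rfl (g := fun _ => p / ((Fintype.card F : ℝ) - 1))
        (fun a ha => if_neg (Finset.ne_of_mem_erase ha))]
    rw [Finset.sum_const, Finset.card_erase_of_mem (Finset.mem_univ _), Finset.card_univ,
      nsmul_eq_mul, Nat.cast_sub Fintype.card_pos]
    have : (Fintype.card F : ℝ) - 1 ≠ 0 := by linarith
    simp only [if_true, Nat.cast_one]
    field_simp
    ring
  unfold noiseProb
  rw [← Fintype.prod_sum (fun (_ : Fin n) (a : F) =>
    if a = 0 then 1 - p else p / ((Fintype.card F : ℝ) - 1))]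
  simp [key]

/-- A randomized decoder: a probability distribution on deterministic decoders `F^n → C`. -/
abbrev RandomizedDecoder {F : Type*} {n : ℕ} (C : Set (Fin n → F)) : Type _ :=
  PMF ((Fin n → F) → C)

/-- `Pr[D(c + z) = c]`, over the randomness of the decoder `D` and an independent `p`-noisy
error string `z`, for a transmitted codeword `c`. -/
def successProb {F : Type*} [Field F] [Fintype F] [DecidableEq F] {n : ℕ} {C : Set (Fin n → F)}
    (D : RandomizedDecoder C) (p : ℝ) (c : C) : ℝ :=
  ∑ z : Fin n → F, noiseProb p z * (D.toOuterMeasure {d | d (↑c + z) = c}).toReal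

/-- The sequence `C n ⊆ (F n)^n` achieves list-decoding capacity for a `p`-fraction of adversarial
corruptions: its rate is `1 - h_q(p) + o(1)`, and for all list sizes `L(n) = ω(1)` there is
`ε(n) = o(1)` such that each `C n` is `(p - ε(n), L(n))`-list-decodable. -/
def AchievesListDecodingCapacity {F : ℕ → Type*} [∀ n, Fintype (F n)] [∀ n, DecidableEq (F n)]
    (C : ∀ n, Set (Fin n → F n)) (p : ℝ) : Prop :=
  Tendsto (fun n => rate (C n) - (1 - qEntropy (Fintype.card (F n)) p)) atTop (𝓝 0) ∧
  ∀ L : ℕ → ℕ, (∀ n, 1 ≤ L n) → Tendsto L atTop atTop →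
    ∃ ε : ℕ → ℝ, Tendsto ε atTop (𝓝 0) ∧ ∀ n, IsListDecodable (C n) (p - ε n) (L n)

/-- The sequence `C n ⊆ (F n)^n` achieves capacity on the `q`-ary symmetric channel with error
probability `p`: its rate is `1 - h_q(p) + o(1)`, and for some `ε(n) = o(1)` each `C n` has a
decoder that recovers every codeword from `(p - ε(n))`-noise with probability at least `1 - ε(n)`.
The bounds `0 ≤ ε(n) ≤ p` make `p - ε(n)` a noise level. -/
def AchievesQSCCapacity {F : ℕ → Type*} [∀ n, Field (F n)] [∀ n, Fintype (F n)]
    [∀ n, DecidableEq (F n)] (C : ∀ n, Set (Fin n → F n)) (p : ℝ) : Prop :=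
  Tendsto (fun n => rate (C n) - (1 - qEntropy (Fintype.card (F n)) p)) atTop (𝓝 0) ∧
  ∃ ε : ℕ → ℝ, Tendsto ε atTop (𝓝 0) ∧ (∀ n, 0 ≤ ε n ∧ ε n ≤ p) ∧
    ∀ n, ∃ D : RandomizedDecoder (C n), ∀ c : C n, 1 - ε n ≤ successProb D (p - ε n) c

end CapacityBridge

end

/-! Noise of level `p - ε` is produced in two stages: a string `z` of noise level `s = p - ε/2`,
then an erasure of each entry to `0` with a fixed small probability `η`. Nearest-codeword decoding
succeeds when the result is strictly lightest in its coset, so only the two stages need analysis.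
Below, `|·|` is Hamming weight.

Stage one. Eventually `p ≤ 1 - 1/q`, so lighter strings are likelier. A coset has at most `L`
strings within the list-decoding radius, where `z` lies with high probability; hence `z` is lightest
in its coset with probability at least `1/(2L)` (`prodExp_light_le_mul_leader`). Concentration
improves this weak bound. The deficit `max_c (|z| - |z - c|)/√|c|` vanishes at coset leaders, and
the factor `√|c|` is chosen so that a one-sided Efron–Stein inequality bounds its variance by `4`
(`efronStein`, `deficit_variance_le`). Its second moment is therefore `O(L)`, and it is below `T =
4L` outside an event of probability `O(1/L)`.

Stage two. By list decoding around `z`, at most `L` codewords `c` tie with or beat `z`. For each of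
them `z` is nonzero on at least half the support of `c`, so erasures gain about `η|c|/2` or more,
against a deficit of at most `T√|c|`. Since `|c| ≥ L^4`, the gain wins for large `L`; a union bound
finishes, because erasures create no new competitors (`prodExp_not_strictLeader_mask_le`). -/

namespace CapacityBridge

/-- The expectation of `f` under the `n`-fold product of the weight `w`. -/
noncomputable def prodExp {α : Type*} [Fintype α] {n : ℕ} (w : α → ℝ) (f : (Fin n → α) → ℝ) : ℝ :=
  ∑ x, (∏ i, w (x i)) * f x

/-! ### Variance inequalities for product measures -/

section ProdExp

variable {α : Type*} [Fintype α] {n : ℕ} {w : α → ℝ}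

theorem prodExp_mono (hw : ∀ a, 0 ≤ w a) {f g : (Fin n → α) → ℝ} (h : ∀ x, f x ≤ g x) :
    prodExp w f ≤ prodExp w g :=
  Finset.sum_le_sum fun x _ =>
    mul_le_mul_of_nonneg_left (h x) (Finset.prod_nonneg fun i _ => hw (x i))

theorem prodExp_const (hw1 : ∑ a, w a = 1) (r : ℝ) :
    prodExp w (fun _ : Fin n → α => r) = r := by
  classical
  unfold prodExp
  rw [← Finset.sum_mul, ← Fintype.prod_sum (fun (_ : Fin n) (a : α) => w a)]
  simp [hw1]

theorem prodExp_add (f g : (Fin n → α) → ℝ) :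
    prodExp w (fun x => f x + g x) = prodExp w f + prodExp w g := by
  simp [prodExp, mul_add, Finset.sum_add_distrib]

theorem prodExp_sub (f g : (Fin n → α) → ℝ) :
    prodExp w (fun x => f x - g x) = prodExp w f - prodExp w g := by
  simp [prodExp, mul_sub, Finset.sum_sub_distrib]

theorem prodExp_const_mul (r : ℝ) (f : (Fin n → α) → ℝ) :
    prodExp w (fun x => r * f x) = r * prodExp w f := by
  simp only [prodExp, Finset.mul_sum]
  exact Finset.sum_congr rfl fun x _ => by ring

theorem prodExp_sum {ι : Type*} (s : Finset ι) (f : ι → (Fin n → α) → ℝ) :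
    prodExp w (fun x => ∑ j ∈ s, f j x) = ∑ j ∈ s, prodExp w (f j) := by
  simp only [prodExp, Finset.mul_sum]
  exact Finset.sum_comm

theorem prodExp_succ (f : (Fin (n + 1) → α) → ℝ) :
    prodExp w f = prodExp w fun y : Fin n → α => ∑ a, w a * f (Fin.cons a y) := by
  unfold prodExp
  rw [← (Fin.consEquiv fun _ : Fin (n + 1) => α).sum_comp, Fintype.sum_prod_type,
    Finset.sum_comm]
  refine Finset.sum_congr rfl fun y _ => ?_
  rw [Finset.mul_sum]
  refine Finset.sum_congr rfl fun a _ => ?_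
  change (∏ i, w ((Fin.cons a y : Fin (n + 1) → α) i)) * f (Fin.cons a y) = _
  rw [Fin.prod_univ_succ]
  simp only [Fin.cons_zero, Fin.cons_succ]
  ring

theorem prodExp_apply (hw1 : ∑ a, w a = 1) (g : α → ℝ) (i : Fin n) :
    prodExp w (fun x => g (x i)) = ∑ a, w a * g a := by
  classical
  have h : ∀ x : Fin n → α, (∏ j, w (x j)) * g (x i) =
      ∏ j, w (x j) * (if j = i then g (x j) else 1) := fun x => by
    rw [Finset.prod_mul_distrib, Finset.prod_ite_eq' Finset.univ i]
    simp
  unfold prodExp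
  simp_rw [h]
  rw [← Fintype.prod_sum (fun (j : Fin n) (a : α) => w a * (if j = i then g a else 1)),
    Finset.prod_eq_single i]
  · simp
  · intro j _ hj
    simp [hj, hw1]
  · simp

/-- The variance of `φ` as the mean squared positive part of the difference of two independent
copies. -/
theorem sum_sq_sub_sq_sum (hw1 : ∑ a, w a = 1) (φ : α → ℝ) :
    ∑ a, w a * φ a ^ 2 - (∑ a, w a * φ a) ^ 2 =
      ∑ a, w a * ∑ b, w b * max (φ a - φ b) 0 ^ 2 := by
  have hsplit : ∀ t : ℝ, t ^ 2 = max t 0 ^ 2 + max (-t) 0 ^ 2 := fun t => by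
    rcases le_total t 0 with h | h
    · rw [max_eq_right h, max_eq_left (by linarith)]; ring
    · rw [max_eq_left h, max_eq_right (by linarith)]; ring
  have hswap : ∑ a, w a * ∑ b, w b * max (-(φ a - φ b)) 0 ^ 2 =
      ∑ a, w a * ∑ b, w b * max (φ a - φ b) 0 ^ 2 := by
    simp_rw [Finset.mul_sum]
    rw [Finset.sum_comm]
    refine Finset.sum_congr rfl fun a _ => Finset.sum_congr rfl fun b _ => ?_
    rw [neg_sub]; ring
  have hfull : ∑ a, w a * ∑ b, w b * (φ a - φ b) ^ 2 =
      2 * (∑ a, w a * φ a ^ 2 - (∑ a, w a * φ a) ^ 2) := by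
    have h1 : ∀ a, ∑ b, w b * (φ a - φ b) ^ 2 =
        φ a ^ 2 - 2 * φ a * (∑ b, w b * φ b) + ∑ b, w b * φ b ^ 2 := fun a => by
      calc ∑ b, w b * (φ a - φ b) ^ 2
          = ∑ b, (w b * φ a ^ 2 - 2 * φ a * (w b * φ b) + w b * φ b ^ 2) :=
            Finset.sum_congr rfl fun b _ => by ring
        _ = _ := by
            rw [Finset.sum_add_distrib, Finset.sum_sub_distrib, ← Finset.sum_mul, hw1,
              ← Finset.mul_sum, one_mul]
    simp_rw [h1]
    set m := ∑ b, w b * φ b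
    set v := ∑ b, w b * φ b ^ 2
    calc ∑ a, w a * (φ a ^ 2 - 2 * φ a * m + v)
        = ∑ a, (w a * φ a ^ 2 - 2 * m * (w a * φ a) + w a * v) :=
          Finset.sum_congr rfl fun a _ => by ring
      _ = 2 * (v - m ^ 2) := by
          rw [Finset.sum_add_distrib, Finset.sum_sub_distrib, ← Finset.sum_mul, hw1,
            ← Finset.mul_sum]
          ring
  have : ∑ a, w a * ∑ b, w b * (φ a - φ b) ^ 2 =
      ∑ a, w a * ∑ b, w b * max (φ a - φ b) 0 ^ 2 +
        ∑ a, w a * ∑ b, w b * max (-(φ a - φ b)) 0 ^ 2 := by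
    rw [← Finset.sum_add_distrib]
    refine Finset.sum_congr rfl fun a _ => ?_
    rw [← mul_add, ← Finset.sum_add_distrib]
    congr 1
    refine Finset.sum_congr rfl fun b _ => ?_
    rw [← mul_add, ← hsplit]
  linarith

/-- Jensen's inequality for the convex function `max t 0 ^ 2`. It carries the one-sided differences
through an average in the induction for `efronStein`. -/
theorem posPart_sq_sum_le (hw : ∀ a, 0 ≤ w a) (hw1 : ∑ a, w a = 1) (t : α → ℝ) :
    max (∑ a, w a * t a) 0 ^ 2 ≤ ∑ a, w a * max (t a) 0 ^ 2 := by
  have h1 : max (∑ a, w a * t a) 0 ≤ ∑ a, w a * max (t a) 0 :=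
    max_le (Finset.sum_le_sum fun a _ => mul_le_mul_of_nonneg_left (le_max_left _ _) (hw a))
      (Finset.sum_nonneg fun a _ => mul_nonneg (hw a) (le_max_right _ _))
  have h2 := sum_sq_sub_sq_sum hw1 fun a => max (t a) 0
  have h3 : 0 ≤ ∑ a, w a * ∑ b, w b * max (max (t a) 0 - max (t b) 0) 0 ^ 2 :=
    Finset.sum_nonneg fun a _ => mul_nonneg (hw a)
      (Finset.sum_nonneg fun b _ => mul_nonneg (hw b) (sq_nonneg _))
  have h4 := pow_le_pow_left₀ (le_max_right _ _) h1 2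
  linarith

/-- The Efron–Stein inequality. -/
theorem efronStein (hw : ∀ a, 0 ≤ w a) (hw1 : ∑ a, w a = 1) (f : (Fin n → α) → ℝ) :
    prodExp w (fun x => f x ^ 2) - prodExp w f ^ 2 ≤
      prodExp w fun x => ∑ i, ∑ a, w a * max (f x - f (Function.update x i a)) 0 ^ 2 := by
  induction n with
  | zero => simp [prodExp]
  | succ n ih =>
    set g : (Fin n → α) → ℝ := fun y => ∑ a, w a * f (Fin.cons a y) with hg
    have hrhs : prodExp w (fun x : Fin (n + 1) → α =>
        ∑ i, ∑ a, w a * max (f x - f (Function.update x i a)) 0 ^ 2) =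
        prodExp w (fun y => ∑ a, w a * ∑ b, w b *
          max (f (Fin.cons a y) - f (Fin.cons b y)) 0 ^ 2) +
        prodExp w (fun y => ∑ i, ∑ b, w b * ∑ a, w a *
          max (f (Fin.cons a y) - f (Fin.cons a (Function.update y i b))) 0 ^ 2) := by
      rw [prodExp_succ, ← prodExp_add]
      congr 1
      funext y
      simp only [Fin.sum_univ_succ, Fin.update_cons_zero, ← Fin.cons_update, mul_add,
        Finset.sum_add_distrib]
      congr 1
      simp_rw [Finset.mul_sum]
      rw [Finset.sum_comm]
      refine Finset.sum_congr rfl fun i _ => ?_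
      rw [Finset.sum_comm]
      exact Finset.sum_congr rfl fun b _ => Finset.sum_congr rfl fun a _ => by ring
    -- Law of total variance, conditioning on all coordinates but the first: mean conditional
    -- variance plus the variance of the conditional mean `g`.
    have hlhs : prodExp w (fun x => f x ^ 2) - prodExp w f ^ 2 =
        prodExp w (fun y => ∑ a, w a * ∑ b, w b *
          max (f (Fin.cons a y) - f (Fin.cons b y)) 0 ^ 2) +
        (prodExp w (fun y => g y ^ 2) - prodExp w g ^ 2) := by
      rw [prodExp_succ, prodExp_succ f]
      have : (fun y : Fin n → α => ∑ a, w a * f (Fin.cons a y) ^ 2) = fun y =>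
          (∑ a, w a * ∑ b, w b * max (f (Fin.cons a y) - f (Fin.cons b y)) 0 ^ 2) + g y ^ 2 := by
        funext y
        have := sum_sq_sub_sq_sum hw1 fun a => f (Fin.cons a y)
        simp only [hg]
        linarith
      rw [this, prodExp_add]
      ring
    rw [hrhs, hlhs]
    gcongr
    refine (ih g).trans (prodExp_mono hw fun y => Finset.sum_le_sum fun i _ =>
      Finset.sum_le_sum fun b _ => mul_le_mul_of_nonneg_left ?_ (hw b))
    have : g y - g (Function.update y i b) =
        ∑ a, w a * (f (Fin.cons a y) - f (Fin.cons a (Function.update y i b))) := by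
      simp only [hg, mul_sub, Finset.sum_sub_distrib]
    rw [this]
    exact posPart_sq_sum_le hw hw1 _

/-- Markov's inequality for the probability that `P` holds, when `P` forces `g` to be large. -/
theorem prodExp_indicator_le (hw : ∀ a, 0 ≤ w a) (P : (Fin n → α) → Prop) [DecidablePred P]
    (g : (Fin n → α) → ℝ) (hg : ∀ x, 0 ≤ g x) {t : ℝ} (ht : 0 < t) (h : ∀ x, P x → t ≤ g x) :
    prodExp w (fun x => if P x then 1 else 0) ≤ prodExp w g / t := by
  rw [div_eq_inv_mul, ← prodExp_const_mul]
  refine prodExp_mono hw fun x => ?_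
  split_ifs with hx
  · rw [← div_eq_inv_mul]
    exact (one_le_div ht).2 (h x hx)
  · exact mul_nonneg (inv_nonneg.2 ht.le) (hg x)

/-- A sum of independent `[0, 1]`-valued variables with mean `m` has variance at most `m`. -/
theorem prodExp_sum_sub_mean_sq_le (hw : ∀ a, 0 ≤ w a) (hw1 : ∑ a, w a = 1)
    (u : Fin n → α → ℝ) (hu0 : ∀ i a, 0 ≤ u i a) (hu1 : ∀ i a, u i a ≤ 1) {m : ℝ}
    (hm : ∑ i, ∑ a, w a * u i a = m) :
    prodExp w (fun x => (∑ i, u i (x i) - m) ^ 2) ≤ m := by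
  have hmean : prodExp w (fun x => ∑ i, u i (x i)) = m := by
    rw [prodExp_sum, ← hm]
    exact Finset.sum_congr rfl fun i _ => prodExp_apply hw1 _ i
  have hvar : prodExp w (fun x => (∑ i, u i (x i) - m) ^ 2) =
      prodExp w (fun x => (∑ i, u i (x i)) ^ 2) - m ^ 2 := by
    have : (fun x : Fin n → α => (∑ i, u i (x i) - m) ^ 2) = fun x =>
        ((∑ i, u i (x i)) ^ 2 - (2 * m) * (∑ i, u i (x i))) + m ^ 2 := by
      funext x; ring
    rw [this, prodExp_add, prodExp_sub, prodExp_const_mul, hmean, prodExp_const hw1]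
    ring
  have hES := efronStein hw hw1 fun x : Fin n → α => ∑ i, u i (x i)
  rw [hmean] at hES
  rw [hvar]
  refine hES.trans ?_
  rw [← hmean]
  refine prodExp_mono hw fun x => Finset.sum_le_sum fun i _ => ?_
  have hdiff : ∀ a, ∑ j, u j (x j) - ∑ j, u j (Function.update x i a j) = u i (x i) - u i a :=
    fun a => by
    rw [← Finset.sum_sub_distrib, Finset.sum_eq_single i]
    · simp
    · intro j _ hj
      simp [hj]
    · simp
  calc ∑ a, w a * max (∑ j, u j (x j) - ∑ j, u j (Function.update x i a j)) 0 ^ 2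
      ≤ ∑ a, w a * u i (x i) := by
        refine Finset.sum_le_sum fun a _ => mul_le_mul_of_nonneg_left ?_ (hw a)
        rw [hdiff]
        -- The one-sided difference lies between `0` and `u i (x i) ≤ 1`, so its square is at most
        -- `u i (x i)`.
        have h1 : max (u i (x i) - u i a) 0 ≤ u i (x i) :=
          max_le (by linarith [hu0 i a]) (hu0 _ _)
        have h2 := pow_le_pow_left₀ (le_max_right _ _) h1 2
        nlinarith [hu0 i (x i), hu1 i (x i)]
    _ = u i (x i) := by rw [← Finset.sum_mul, hw1, one_mul]

/-- With mean `m`, the event `P` alone contributes at least `π m²` to the variance, since `f` is at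
distance `|m|` from its mean there. Thus `m² ≤ v / π`, and the second moment is variance plus `m²`.
-/
theorem prodExp_sq_le_of_vanishing (hw : ∀ a, 0 ≤ w a) (hw1 : ∑ a, w a = 1)
    (f : (Fin n → α) → ℝ) (P : (Fin n → α) → Prop) [DecidablePred P] (hP : ∀ x, P x → f x = 0)
    {v π : ℝ} (hπ : 0 < π) (hprob : π ≤ prodExp w fun x => if P x then 1 else 0)
    (hvar : prodExp w (fun x => f x ^ 2) - prodExp w f ^ 2 ≤ v) :
    prodExp w (fun x => f x ^ 2) ≤ v + v / π := by
  set m := prodExp w f with hm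
  have h1 : prodExp w (fun x => m ^ 2 * if P x then 1 else 0) ≤
      prodExp w (fun x => (f x ^ 2 - (2 * m) * f x) + m ^ 2) := by
    refine prodExp_mono hw fun x => ?_
    split_ifs with h
    · simp [hP x h]
    · nlinarith [sq_nonneg (f x - m)]
  rw [prodExp_const_mul, prodExp_add, prodExp_sub, prodExp_const_mul, prodExp_const hw1, ← hm]
    at h1
  have h2 : m ^ 2 ≤ v / π := by
    rw [le_div_iff₀ hπ]
    nlinarith [mul_le_mul_of_nonneg_left hprob (sq_nonneg m)]
  linarith

end ProdExp

/-- The law of one entry of an `s`-noisy error string. -/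
noncomputable def symbolWeight {F : Type*} [Field F] [Fintype F] [DecidableEq F] (s : ℝ) (a : F) :
    ℝ :=
  if a = 0 then 1 - s else s / ((Fintype.card F : ℝ) - 1)

/-- The law of a `{0, 1}`-valued variable that is `1` with probability `η`. -/
noncomputable def maskWeight (η : ℝ) (b : Bool) : ℝ := if b then η else 1 - η

/-- The string obtained from `z` by replacing the entries marked by `b` with `0`. -/
def mask {F : Type*} [Zero F] {n : ℕ} (b : Fin n → Bool) (z : Fin n → F) : Fin n → F :=
  fun i => if b i then 0 else z i

/-- By how much the error string `z` is lighter than the competing string `z - c`. -/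
def margin {F : Type*} [Field F] [DecidableEq F] {n : ℕ} (c z : Fin n → F) : ℝ :=
  (hammingNorm (z - c) : ℝ) - hammingNorm z

/-- The largest normalized advantage of a competing error string `z - c`, `c ∈ C`, over `z`. -/
noncomputable def deficit {F : Type*} [Field F] [DecidableEq F] {n : ℕ}
    (C : Submodule F (Fin n → F)) (z : Fin n → F) : ℝ :=
  ⨆ c : C, -margin (c : Fin n → F) z / √(hammingNorm (c : Fin n → F))

/-! ### The laws of noise and random erasure -/

section Weights

theorem hammingNorm_eq_sum {F : Type*} [Field F] [DecidableEq F] {n : ℕ} (z : Fin n → F) :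
    (hammingNorm z : ℝ) = ∑ i, if z i ≠ 0 then 1 else 0 := by
  simp [hammingNorm, Finset.card_filter]

theorem maskWeight_nonneg {η : ℝ} (h0 : 0 ≤ η) (h1 : η ≤ 1) (b : Bool) : 0 ≤ maskWeight η b := by
  cases b <;> simp [maskWeight, h0, h1]

theorem sum_maskWeight (η : ℝ) : ∑ b, maskWeight η b = 1 := by
  simp [maskWeight]

variable {F : Type*} [Field F] [Fintype F] [DecidableEq F] {n : ℕ}

theorem one_lt_card_real (F : Type*) [Field F] [Fintype F] : (1 : ℝ) < Fintype.card F := by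
  exact_mod_cast Fintype.one_lt_card

theorem symbolWeight_nonneg {s : ℝ} (h0 : 0 ≤ s) (h1 : s ≤ 1) (a : F) : 0 ≤ symbolWeight s a := by
  have := one_lt_card_real F
  unfold symbolWeight
  split_ifs
  · linarith
  · exact div_nonneg h0 (by linarith)

theorem sum_symbolWeight_mul (s : ℝ) (g : F → ℝ) (t : ℝ) (hg : ∀ a, a ≠ 0 → g a = t) :
    ∑ a, symbolWeight s a * g a = (1 - s) * g 0 + s * t := by
  have hq := one_lt_card_real F
  rw [← Finset.add_sum_erase _ _ (Finset.mem_univ (0 : F)),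
    Finset.sum_congr rfl (g := fun _ => s / ((Fintype.card F : ℝ) - 1) * t)
      (fun a ha => by rw [symbolWeight, if_neg (Finset.ne_of_mem_erase ha),
        hg a (Finset.ne_of_mem_erase ha)])]
  rw [Finset.sum_const, Finset.card_erase_of_mem (Finset.mem_univ _), Finset.card_univ,
    nsmul_eq_mul, Nat.cast_sub Fintype.card_pos]
  have : (Fintype.card F : ℝ) - 1 ≠ 0 := by linarith
  simp only [symbolWeight, if_true, Nat.cast_one]
  field_simp

theorem sum_symbolWeight (s : ℝ) : ∑ a : F, symbolWeight s a = 1 := by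
  simpa using sum_symbolWeight_mul (F := F) s (fun _ => 1) 1 fun _ _ => rfl

theorem sum_noiseProb_mul (s : ℝ) (f : (Fin n → F) → ℝ) :
    ∑ z, noiseProb s z * f z = prodExp (symbolWeight s) f := rfl

/-- Erasing each entry of an `s`-noisy string to `0` with probability `η` gives
`s (1 - η)`-noise. -/
theorem prodExp_mask (s η : ℝ) (g : (Fin n → F) → ℝ) :
    prodExp (symbolWeight (s * (1 - η))) g =
      prodExp (symbolWeight s) fun z => prodExp (maskWeight η) fun b => g (mask b z) := by
  classical
  -- The identity for one entry; `hstring` multiplies it out over the coordinates.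
  have hsite : ∀ y : F, symbolWeight (s * (1 - η)) y =
      ∑ a : F, ∑ b : Bool, if (if b then 0 else a) = y then symbolWeight s a * maskWeight η b
        else 0 := by
    intro y
    simp only [Fintype.sum_bool, if_true, Bool.false_eq_true, if_false, Finset.sum_add_distrib,
      Finset.sum_ite_eq', Finset.mem_univ, maskWeight]
    by_cases hy : y = 0
    · subst hy
      simp only [if_true, ← Finset.sum_mul, sum_symbolWeight]
      simp only [symbolWeight, if_true]
      ring
    · rw [Finset.sum_eq_zero (fun a _ => if_neg (Ne.symm hy))]
      simp only [symbolWeight, if_neg hy]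
      ring
  have hstring : ∀ y : Fin n → F, ∏ i, symbolWeight (s * (1 - η)) (y i) =
      ∑ z : Fin n → F, ∑ b : Fin n → Bool,
        if mask b z = y then (∏ i, symbolWeight s (z i)) * ∏ i, maskWeight η (b i) else 0 := by
    intro y
    simp_rw [hsite]
    rw [Fintype.prod_sum]
    refine Finset.sum_congr rfl fun z _ => ?_
    rw [Fintype.prod_sum]
    refine Finset.sum_congr rfl fun b _ => ?_
    rw [Finset.prod_ite_zero, ← Finset.prod_mul_distrib]
    simp [mask, funext_iff]
  unfold prodExp
  simp_rw [hstring, Finset.sum_mul, Finset.mul_sum]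
  rw [Finset.sum_comm]
  refine Finset.sum_congr rfl fun z _ => ?_
  rw [Finset.sum_comm]
  refine Finset.sum_congr rfl fun b _ => ?_
  simp only [ite_mul, zero_mul, Finset.sum_ite_eq, Finset.mem_univ, if_true]
  ring

theorem noiseProb_eq_pow (s : ℝ) (z : Fin n → F) : noiseProb s z =
    (s / ((Fintype.card F : ℝ) - 1)) ^ hammingNorm z * (1 - s) ^ (n - hammingNorm z) := by
  have hcard := Finset.card_filter_add_card_filter_not (s := (Finset.univ : Finset (Fin n)))
    (fun i => z i = 0)
  have h1 : n - hammingNorm z = (Finset.univ.filter fun i => z i = 0).card := by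
    simp only [Finset.card_univ, Fintype.card_fin] at hcard
    simp only [hammingNorm, ne_eq]
    omega
  unfold noiseProb
  rw [Finset.prod_ite, Finset.prod_const, Finset.prod_const, h1, mul_comm]
  rfl

/-- The bound on `s` says precisely that a given nonzero symbol is no likelier than `0`, that is `s
/ (q - 1) ≤ 1 - s`. -/
theorem noiseProb_le_of_hammingNorm_le {s : ℝ} (h0 : 0 ≤ s)
    (hs : s ≤ 1 - 1 / (Fintype.card F : ℝ)) {z z' : Fin n → F}
    (h : hammingNorm z ≤ hammingNorm z') : noiseProb s z' ≤ noiseProb s z := by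
  have hq := one_lt_card_real F
  have ha : 0 ≤ s / ((Fintype.card F : ℝ) - 1) := div_nonneg h0 (by linarith)
  have hab : s / ((Fintype.card F : ℝ) - 1) ≤ 1 - s := by
    rw [div_le_iff₀ (by linarith)]
    have : s * Fintype.card F ≤ (1 - 1 / (Fintype.card F : ℝ)) * Fintype.card F :=
      mul_le_mul_of_nonneg_right hs (by linarith)
    have h2 : (1 - 1 / (Fintype.card F : ℝ)) * Fintype.card F = Fintype.card F - 1 := by
      field_simp
    nlinarith
  have hn : hammingNorm z' ≤ n := by simpa using hammingNorm_le_card_fintype (x := z')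
  rw [noiseProb_eq_pow, noiseProb_eq_pow]
  obtain ⟨j, hj⟩ := Nat.exists_eq_add_of_le h
  have e : n - hammingNorm z = j + (n - hammingNorm z') := by omega
  rw [e, hj, pow_add, pow_add, mul_assoc]
  have hb : 0 ≤ 1 - s := ha.trans hab
  gcongr

/-- Chebyshev's inequality for the weight of an error string. -/
theorem prodExp_heavy_le {s r : ℝ} (h0 : 0 ≤ s) (h1 : s ≤ 1) (hsr : s < r) (hn : 0 < n) :
    prodExp (symbolWeight s) (fun z : Fin n → F => if (hammingNorm z : ℝ) ≤ r * n then 0 else 1) ≤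
      1 / (n * (r - s) ^ 2) := by
  have hn' : (0 : ℝ) < n := by exact_mod_cast hn
  have hvar := prodExp_sum_sub_mean_sq_le (symbolWeight_nonneg (F := F) h0 h1) (sum_symbolWeight s)
    (fun (_ : Fin n) (a : F) => if a ≠ 0 then 1 else 0) (fun _ a => by positivity)
    (fun _ a => by split_ifs <;> norm_num) (m := s * n) (by
      simp only [sum_symbolWeight_mul (F := F) s (fun a => if a ≠ 0 then 1 else 0) 1
        (fun a ha => if_pos ha)]
      simp [mul_comm])
  simp only [← hammingNorm_eq_sum] at hvar
  have hd : 0 < r - s := by linarith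
  have hM := prodExp_indicator_le (symbolWeight_nonneg (F := F) h0 h1)
    (fun z : Fin n → F => ¬ (hammingNorm z : ℝ) ≤ r * n)
    (fun z => ((hammingNorm z : ℝ) - s * n) ^ 2) (fun _ => sq_nonneg _)
    (t := ((r - s) * n) ^ 2) (by positivity) (fun z hz => by
      have : 0 ≤ (r - s) * n := by positivity
      refine pow_le_pow_left₀ this ?_ 2
      push Not at hz
      linarith)
  simp only [ite_not] at hM
  refine hM.trans ((div_le_div_of_nonneg_right hvar (by positivity)).trans ?_)
  rw [div_le_div_iff₀ (by positivity) (by positivity)]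
  have : 0 ≤ (n : ℝ) * (n * (r - s) ^ 2) := by positivity
  nlinarith

end Weights

/-! ### Margins, erasures and the variance of the deficit -/

section Margin

variable {F : Type*} [Field F] [DecidableEq F] {n : ℕ}

theorem hammingDist_eq_norm_sub (w c : Fin n → F) : hammingDist w c = hammingNorm (w - c) := by
  rw [hammingDist_comm, hammingDist_eq_hammingNorm, neg_add_eq_sub]

theorem margin_eq_sum (c z : Fin n → F) : margin c z =
    ∑ i, ((if z i - c i ≠ 0 then 1 else 0) - (if z i ≠ 0 then 1 else 0) : ℝ) := by
  simp [margin, hammingNorm, Finset.card_filter]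

/-- Coordinates outside the support of `c` contribute nothing to the margin; the others contribute
between `-1` and `1`. -/
theorem margin_update_sub_le (c z : Fin n → F) (i : Fin n) (a : F) :
    margin c (Function.update z i a) - margin c z ≤ if c i ≠ 0 then 2 else 0 := by
  rw [margin_eq_sum, margin_eq_sum, ← Finset.sum_sub_distrib, Finset.sum_eq_single i]
  · by_cases hc : c i = 0
    · simp [hc]
    · simp only [Function.update_self]
      split_ifs <;> norm_num
  · intro j _ hj
    simp [hj]
  · simp

/-- An erased coordinate in the support of `c` contributes `1` afterwards; before, it contributed at
most `0` if `z` was nonzero there and `1` otherwise. In particular erasing never lowers a margin. -/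
theorem margin_add_le_margin_mask (c z : Fin n → F) (b : Fin n → Bool) :
    margin c z + (∑ i, if b i ∧ c i ≠ 0 ∧ z i ≠ 0 then 1 else 0) ≤ margin c (mask b z) := by
  rw [margin_eq_sum, margin_eq_sum, ← Finset.sum_add_distrib]
  refine Finset.sum_le_sum fun i _ => ?_
  unfold mask
  by_cases hb : b i <;> by_cases hc : c i = 0 <;> by_cases hz : z i = 0 <;> simp [hb, hc, hz]
  split_ifs <;> norm_num

/-- On the support of `c` a coordinate contributes `1` where `z` vanishes and at least `-1`
elsewhere. So a nonpositive margin forces `z` to be nonzero on at least half of that support, which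
leaves room for erasures to help. -/
theorem hammingNorm_le_margin_add (c z : Fin n → F) :
    (hammingNorm c : ℝ) ≤ margin c z + 2 * ∑ i, if c i ≠ 0 ∧ z i ≠ 0 then 1 else 0 := by
  rw [margin_eq_sum, Finset.mul_sum, ← Finset.sum_add_distrib]
  rw [hammingNorm_eq_sum]
  refine Finset.sum_le_sum fun i _ => ?_
  by_cases hc : c i = 0 <;> by_cases hz : z i = 0 <;> simp [hc, hz]
  split_ifs <;> norm_num

/-- A competing codeword of large weight and moderate advantage is beaten after random erasures. -/
theorem prodExp_margin_mask_nonpos_le {η T : ℝ} (hη0 : 0 < η) (hη1 : η ≤ 1) {c z : Fin n → F}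
    (hc : 0 < hammingNorm c) (hz : margin c z ≤ 0) (hT : -margin c z ≤ T * √(hammingNorm c))
    (hTη : 4 * T ≤ η * √(hammingNorm c)) :
    prodExp (maskWeight η) (fun b => if margin c (mask b z) ≤ 0 then 1 else 0) ≤
      8 / (η * hammingNorm c) := by
  classical
  have hk : (0 : ℝ) < hammingNorm c := by exact_mod_cast hc
  set S : ℝ := ∑ i, if c i ≠ 0 ∧ z i ≠ 0 then 1 else 0 with hS
  have hSk : (hammingNorm c : ℝ) / 2 ≤ S := by
    have := hammingNorm_le_margin_add c z
    linarith
  set m : ℝ := η * S with hm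
  have hm0 : 0 < m := mul_pos hη0 (by linarith)
  have hvar := prodExp_sum_sub_mean_sq_le (maskWeight_nonneg hη0.le hη1) (sum_maskWeight η)
    (fun (i : Fin n) (b : Bool) => if b ∧ c i ≠ 0 ∧ z i ≠ 0 then 1 else 0)
    (fun _ a => by positivity) (fun _ a => by split_ifs <;> norm_num) (m := m) (by
      rw [hm, hS, Finset.mul_sum]
      refine Finset.sum_congr rfl fun i _ => ?_
      simp [maskWeight])
  have hM := prodExp_indicator_le (maskWeight_nonneg hη0.le hη1)
    (fun b : Fin n → Bool => margin c (mask b z) ≤ 0) _ (fun _ => sq_nonneg _)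
    (t := (m / 2) ^ 2) (by positivity) (fun b hb => by
      have h1 := margin_add_le_margin_mask c z b
      -- The mean gain is `m ≥ η|c|/2`, while `T√|c| ≤ η|c|/4`. If `c` still competes, the gain is
      -- at most `m / 2`; as its variance is at most `m`, Chebyshev gives `4 / m ≤ 8 / (η|c|)`.
      have h2 : T * √(hammingNorm c) ≤ m / 2 := by
        have h3 := Real.mul_self_sqrt hk.le
        have h4 := mul_le_mul_of_nonneg_right hTη (Real.sqrt_nonneg (hammingNorm c))
        nlinarith
      rw [← neg_sq (∑ i, (if b i ∧ c i ≠ 0 ∧ z i ≠ 0 then 1 else 0) - m)]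
      refine pow_le_pow_left₀ (by positivity) ?_ 2
      linarith)
  refine hM.trans ((div_le_div_of_nonneg_right hvar (by positivity)).trans ?_)
  rw [div_le_div_iff₀ (by positivity) (by positivity)]
  nlinarith [mul_le_mul_of_nonneg_left hSk hη0.le]

variable [Fintype F] (C : Submodule F (Fin n → F))

theorem le_deficit {c : Fin n → F} (hc : c ∈ C) (z : Fin n → F) :
    -margin c z / √(hammingNorm c) ≤ deficit C z :=
  le_ciSup (f := fun c : C => -margin (c : Fin n → F) z / √(hammingNorm (c : Fin n → F)))
    (Set.finite_range _).bddAbove ⟨c, hc⟩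

theorem deficit_nonneg (z : Fin n → F) : 0 ≤ deficit C z := by
  -- The codeword `0` contributes `0 / √0 = 0`.
  simpa using le_deficit C C.zero_mem z

theorem deficit_eq_zero {z : Fin n → F} (h : ∀ c ∈ C, hammingNorm z ≤ hammingNorm (z - c)) :
    deficit C z = 0 := by
  refine le_antisymm (ciSup_le fun c => ?_) (deficit_nonneg C z)
  refine div_nonpos_of_nonpos_of_nonneg ?_ (Real.sqrt_nonneg _)
  have : (hammingNorm z : ℝ) ≤ hammingNorm (z - (c : Fin n → F)) := by exact_mod_cast h c c.2
  simp only [margin]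
  linarith

/-- Fix a codeword `c` attaining the maximum at `z`. It still bounds the deficit from below after an
update, so the deficit drops by at most `2/√|c|`, and only at the `|c|` coordinates of its support:
the squares sum to at most `4`. Only drops are controlled this way, hence the positive parts. -/
theorem sum_posPart_deficit_sub_update_le {w : F → ℝ} (hw : ∀ a, 0 ≤ w a) (hw1 : ∑ a, w a = 1)
    (z : Fin n → F) :
    ∑ i, ∑ a, w a * max (deficit C z - deficit C (Function.update z i a)) 0 ^ 2 ≤ 4 := by
  obtain ⟨⟨c, hcC⟩, hc⟩ := exists_eq_ciSup_of_finite
    (f := fun c : C => -margin (c : Fin n → F) z / √(hammingNorm (c : Fin n → F)))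
  change -margin c z / √(hammingNorm c) = deficit C z at hc
  -- If the maximizer is `0`, the deficit is already `0` and cannot drop.
  rcases Nat.eq_zero_or_pos (hammingNorm c) with h0 | hpos
  · have hz : deficit C z = 0 := by rw [← hc, h0]; simp
    have : ∀ i a, max (deficit C z - deficit C (Function.update z i a)) 0 = 0 := fun i a => by
      rw [hz, max_eq_right]
      linarith [deficit_nonneg C (Function.update z i a)]
    simp [this]
  have hk : (0 : ℝ) < hammingNorm c := by exact_mod_cast hpos
  have hsite : ∀ i a, max (deficit C z - deficit C (Function.update z i a)) 0 ^ 2 ≤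
      4 / hammingNorm c * if c i ≠ 0 then 1 else 0 := by
    intro i a
    have h1 := le_deficit C hcC (Function.update z i a)
    have h2 := margin_update_sub_le c z i a
    have h3 : deficit C z - deficit C (Function.update z i a) ≤
        (if c i ≠ 0 then 2 else 0) / √(hammingNorm c) := by
      have : deficit C z - deficit C (Function.update z i a) ≤
          (margin c (Function.update z i a) - margin c z) / √(hammingNorm c) := by
        rw [sub_div, ← hc]
        rw [neg_div] at h1 ⊢
        linarith
      exact this.trans (div_le_div_of_nonneg_right h2 (Real.sqrt_nonneg _))
    have h4 : max (deficit C z - deficit C (Function.update z i a)) 0 ≤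
        (if c i ≠ 0 then 2 else 0) / √(hammingNorm c) :=
      max_le h3 (div_nonneg (by positivity) (Real.sqrt_nonneg _))
    refine (pow_le_pow_left₀ (le_max_right _ _) h4 2).trans (le_of_eq ?_)
    rw [div_pow, Real.sq_sqrt hk.le]
    split_ifs <;> ring
  calc ∑ i, ∑ a, w a * max (deficit C z - deficit C (Function.update z i a)) 0 ^ 2
      ≤ ∑ i, ∑ a, w a * (4 / hammingNorm c * if c i ≠ 0 then 1 else 0) :=
        Finset.sum_le_sum fun i _ => Finset.sum_le_sum fun a _ =>
          mul_le_mul_of_nonneg_left (hsite i a) (hw a)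
    _ = ∑ i, 4 / (hammingNorm c : ℝ) * if c i ≠ 0 then 1 else 0 :=
        Finset.sum_congr rfl fun i _ => by rw [← Finset.sum_mul, hw1, one_mul]
    _ = 4 := by
        rw [← Finset.mul_sum, ← hammingNorm_eq_sum, div_mul_cancel₀ _ hk.ne']

/-- The variance of the deficit is at most `4`. -/
theorem deficit_variance_le {w : F → ℝ} (hw : ∀ a, 0 ≤ w a) (hw1 : ∑ a, w a = 1) :
    prodExp w (fun z => deficit C z ^ 2) - prodExp w (deficit C) ^ 2 ≤ 4 :=
  (efronStein hw hw1 _).trans ((prodExp_mono hw fun z =>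
    sum_posPart_deficit_sub_update_le C hw hw1 z).trans (prodExp_const hw1 4).le)

end Margin

/-! ### From list decoding to strict coset leaders -/

section Decoding

theorem IsListDecodable.mono {F : Type*} [Fintype F] [DecidableEq F] {n : ℕ} {r r' : ℝ} {L : ℕ}
    {C : Set (Fin n → F)} (h : IsListDecodable C r L) (hr : r' ≤ r) : IsListDecodable C r' L := fun w =>
  (Set.ncard_le_ncard (fun _ hc => And.imp_right (fun hd => hd.trans
    (mul_le_mul_of_nonneg_right hr (Nat.cast_nonneg n))) hc) (Set.toFinite _)).trans (h w)

variable {F : Type*} [Field F] [Fintype F] [DecidableEq F] {n : ℕ} {C : Submodule F (Fin n → F)}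

/-- In a list-decodable linear code, each coset has few light vectors. -/
theorem IsListDecodable.card_coset_le {r : ℝ} {L : ℕ}
    (h : IsListDecodable (C : Set (Fin n → F)) r L) (a : Fin n → F) (S : Finset (Fin n → F))
    (hS : ∀ z ∈ S, a - z ∈ C ∧ (hammingNorm z : ℝ) ≤ r * n) : S.card ≤ L := by
  classical
  rw [← Finset.card_image_of_injective S (sub_right_injective (b := a)),
    ← Set.ncard_coe_finset]
  refine (Set.ncard_le_ncard (fun c hc => ?_) (Set.toFinite _)).trans (h a)
  simp only [Finset.coe_image, Set.mem_image, Finset.mem_coe] at hc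
  obtain ⟨z, hz, rfl⟩ := hc
  refine ⟨(hS z hz).1, ?_⟩
  rw [hammingDist_eq_norm_sub, sub_sub_cancel]
  exact (hS z hz).2

open Classical in
/-- An error string is of minimum weight in its coset with probability at least `1 / L` times the
probability that it lies within the list-decoding radius. -/
theorem prodExp_light_le_mul_leader {s r : ℝ} (h0 : 0 ≤ s) (h1 : s ≤ 1)
    (hs : s ≤ 1 - 1 / (Fintype.card F : ℝ)) {L : ℕ}
    (h : IsListDecodable (C : Set (Fin n → F)) r L) :
    prodExp (symbolWeight s)
        (fun z : Fin n → F => if (hammingNorm z : ℝ) ≤ r * n then 1 else 0) ≤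
      L * prodExp (symbolWeight s) (fun z : Fin n → F =>
        if ∀ c ∈ C, hammingNorm z ≤ hammingNorm (z - c) then 1 else 0) := by
  have hleader : ∀ z : Fin n → F, ∃ a, a - z ∈ C ∧ hammingNorm a ≤ hammingNorm z ∧
      ∀ c ∈ C, hammingNorm a ≤ hammingNorm (a - c) := by
    intro z
    obtain ⟨a, ha, hmin⟩ := Set.exists_min_image {a | a - z ∈ C} hammingNorm (Set.toFinite _)
      ⟨z, by simp⟩
    refine ⟨a, ha, hmin z (by simp), fun c hc => hmin _ ?_⟩
    have : a - c - z = (a - z) - c := by abel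
    rw [Set.mem_ofPred_eq, this]
    exact C.sub_mem ha hc
  choose l hlC hlz hlmin using hleader
  rw [← sum_noiseProb_mul, ← sum_noiseProb_mul, Finset.mul_sum]
  simp only [mul_ite, mul_one, mul_zero]
  rw [← Finset.sum_filter]
  set B := Finset.univ.filter fun z : Fin n → F => (hammingNorm z : ℝ) ≤ r * n
  -- Each light `z` is charged to its leader `l z`, which is at least as likely; by `card_coset_le`
  -- a leader is charged at most `L` times.
  calc ∑ z ∈ B, noiseProb s z ≤ ∑ z ∈ B, noiseProb s (l z) :=
        Finset.sum_le_sum fun z _ => noiseProb_le_of_hammingNorm_le h0 hs (hlz z)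
    _ = ∑ a, ∑ z ∈ B with l z = a, noiseProb s (l z) :=
        (Finset.sum_fiberwise B l fun z => noiseProb s (l z)).symm
    _ ≤ _ := Finset.sum_le_sum fun a _ => ?_
  by_cases ha : ∀ c ∈ C, hammingNorm a ≤ hammingNorm (a - c)
  · rw [if_pos ha, Finset.sum_congr rfl (g := fun _ => noiseProb s a)
      (fun z hz => by rw [(Finset.mem_filter.1 hz).2]), Finset.sum_const, nsmul_eq_mul]
    refine mul_le_mul_of_nonneg_right ?_ (noiseProb_nonneg h0 h1 a)
    exact_mod_cast h.card_coset_le a _ fun z hz => by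
      obtain ⟨hzB, rfl⟩ := Finset.mem_filter.1 hz
      exact ⟨hlC z, (Finset.mem_filter.1 hzB).2⟩
  · rw [if_neg ha, Finset.sum_eq_zero]
    intro z hz
    exact absurd ((Finset.mem_filter.1 hz).2 ▸ hlmin z) ha

/-- `z` is strictly lighter than all other members of its coset. -/
def IsStrictLeader (C : Submodule F (Fin n → F)) (z : Fin n → F) : Prop :=
  ∀ c ∈ C, c ≠ 0 → hammingNorm z < hammingNorm (z - c)

-- Any codeword competing after the erasures already competed before. Such a `c` puts `z - c` in the
-- ball of radius `r n`, so list decoding centred at `z` leaves at most `L` of them for a union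
-- bound.
open Classical in
theorem prodExp_not_strictLeader_mask_le {η T r k : ℝ} (hη0 : 0 < η) (hη1 : η ≤ 1) {L : ℕ}
    (h : IsListDecodable (C : Set (Fin n → F)) r L) (hk : 0 < k)
    (hmin : ∀ c ∈ C, c ≠ 0 → k ≤ hammingNorm c) (hTk : 4 * T ≤ η * √k) {z : Fin n → F}
    (hz : (hammingNorm z : ℝ) ≤ r * n) (hzT : deficit C z < T) :
    prodExp (maskWeight η) (fun b => if IsStrictLeader C (mask b z) then 0 else 1) ≤
      L * (8 / (η * k)) := by
  set S := Finset.univ.filter fun c : Fin n → F => c ∈ C ∧ c ≠ 0 ∧ margin c z ≤ 0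
  have hcard : S.card ≤ L := by
    rw [← Finset.card_image_of_injective S (sub_right_injective (b := z))]
    refine h.card_coset_le z _ fun y hy => ?_
    obtain ⟨c, hc, rfl⟩ := Finset.mem_image.1 hy
    obtain ⟨hcC, -, hcm⟩ := (Finset.mem_filter.1 hc).2
    refine ⟨by simpa using hcC, ?_⟩
    simp only [margin] at hcm
    linarith
  have hunion : ∀ b : Fin n → Bool, (if IsStrictLeader C (mask b z) then 0 else 1 : ℝ) ≤
      ∑ c ∈ S, if margin c (mask b z) ≤ 0 then 1 else 0 := by
    intro b
    split_ifs with hb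
    · positivity
    · simp only [IsStrictLeader, not_forall, not_lt] at hb
      obtain ⟨c, hcC, hc0, hc⟩ := hb
      have hcb : margin c (mask b z) ≤ 0 := by
        have : (hammingNorm (mask b z - c) : ℝ) ≤ hammingNorm (mask b z) := by exact_mod_cast hc
        simp only [margin]
        linarith
      have hcS : c ∈ S := by
        refine Finset.mem_filter.2 ⟨Finset.mem_univ _, hcC, hc0, ?_⟩
        have h1 := margin_add_le_margin_mask c z b
        have h2 : (0 : ℝ) ≤ ∑ i, if b i ∧ c i ≠ 0 ∧ z i ≠ 0 then 1 else 0 := by positivity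
        linarith
      have := Finset.single_le_sum (f := fun c => if margin c (mask b z) ≤ 0 then (1 : ℝ) else 0)
        (fun c _ => by positivity) hcS
      simpa [hcb] using this
  refine (prodExp_mono (maskWeight_nonneg hη0.le hη1) hunion).trans ?_
  rw [prodExp_sum]
  calc ∑ c ∈ S, prodExp (maskWeight η) (fun b => if margin c (mask b z) ≤ 0 then 1 else 0)
      ≤ ∑ c ∈ S, 8 / (η * k) := Finset.sum_le_sum fun c hc => by
        obtain ⟨hcC, hc0, hcm⟩ := (Finset.mem_filter.1 hc).2
        have hkc := hmin c hcC hc0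
        have hc' : (0 : ℝ) < hammingNorm c := hk.trans_le hkc
        have hdef := (le_deficit C hcC z).trans hzT.le
        rw [div_le_iff₀ (Real.sqrt_pos.2 hc')] at hdef
        refine (prodExp_margin_mask_nonpos_le hη0 hη1 (by exact_mod_cast hc') hcm hdef
          (hTk.trans (by gcongr))).trans ?_
        gcongr
    _ = S.card * (8 / (η * k)) := by rw [Finset.sum_const, nsmul_eq_mul]
    _ ≤ L * (8 / (η * k)) := by gcongr

open Classical in
/-- The probability that a noisy error string is not strictly lightest in its coset. -/
theorem prodExp_not_strictLeader_le {s η r k T ρ : ℝ} (h0 : 0 ≤ s) (h1 : s ≤ 1)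
    (hs : s ≤ 1 - 1 / (Fintype.card F : ℝ)) (hη0 : 0 < η) (hη1 : η ≤ 1) {L : ℕ} (hL : 1 ≤ L)
    (h : IsListDecodable (C : Set (Fin n → F)) r L) (hk : 0 < k)
    (hmin : ∀ c ∈ C, c ≠ 0 → k ≤ hammingNorm c) (hT : 0 < T) (hTk : 4 * T ≤ η * √k)
    (hheavy : prodExp (symbolWeight s)
      (fun z : Fin n → F => if (hammingNorm z : ℝ) ≤ r * n then 0 else 1) ≤ ρ)
    (hρ : ρ ≤ 1 / 2) :
    prodExp (symbolWeight (s * (1 - η)))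
        (fun z : Fin n → F => if IsStrictLeader C z then 0 else 1) ≤
      ρ + 12 * L / T ^ 2 + L * (8 / (η * k)) := by
  have hw := symbolWeight_nonneg (F := F) h0 h1
  have hw1 := sum_symbolWeight (F := F) s
  have hL' : (1 : ℝ) ≤ L := by exact_mod_cast hL
  have hlight : 1 / 2 ≤ prodExp (symbolWeight s)
      (fun z : Fin n → F => if (hammingNorm z : ℝ) ≤ r * n then 1 else 0) := by
    have : (fun z : Fin n → F => if (hammingNorm z : ℝ) ≤ r * n then (1 : ℝ) else 0) =
        fun z => 1 - if (hammingNorm z : ℝ) ≤ r * n then 0 else 1 := by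
      funext z; split_ifs <;> norm_num
    rw [this, prodExp_sub, prodExp_const hw1]
    linarith
  have hleader : 1 / (2 * (L : ℝ)) ≤ prodExp (symbolWeight s) (fun z : Fin n → F =>
      if ∀ c ∈ C, hammingNorm z ≤ hammingNorm (z - c) then 1 else 0) := by
    rw [div_le_iff₀ (by positivity)]
    linarith [prodExp_light_le_mul_leader h0 h1 hs h]
  -- Variance `4` and vanishing probability `1 / (2L)` give `4 + 8L ≤ 12L`.
  have hsq : prodExp (symbolWeight s) (fun z => deficit C z ^ 2) ≤ 12 * L := by
    have := prodExp_sq_le_of_vanishing hw hw1 (deficit C) _ (fun z => deficit_eq_zero C)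
      (by positivity) hleader (deficit_variance_le C hw hw1)
    rw [div_div_eq_mul_div] at this
    linarith
  have hlarge : prodExp (symbolWeight s) (fun z => if T ≤ deficit C z then 1 else 0) ≤
      12 * L / T ^ 2 :=
    (prodExp_indicator_le hw _ (fun z => deficit C z ^ 2) (fun _ => sq_nonneg _) (t := T ^ 2)
      (by positivity) fun z hz => pow_le_pow_left₀ hT.le hz 2).trans (by gcongr)
  rw [prodExp_mask]
  refine (prodExp_mono hw (g := fun z : Fin n → F =>
    ((if (hammingNorm z : ℝ) ≤ r * n then 0 else 1) + if T ≤ deficit C z then 1 else 0) +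
      L * (8 / (η * k))) fun z => ?_).trans ?_
  · have htriv : prodExp (maskWeight η) (fun b => if IsStrictLeader C (mask b z) then 0 else 1) ≤
        (1 : ℝ) :=
      (prodExp_mono (maskWeight_nonneg hη0.le hη1) (g := fun _ => 1) fun b => by
        split_ifs <;> norm_num).trans (prodExp_const (sum_maskWeight η) 1).le
    have hnn : 0 ≤ L * (8 / (η * k)) := by positivity
    by_cases hz : (hammingNorm z : ℝ) ≤ r * n
    · by_cases hzT : T ≤ deficit C z
      · simp only [hz, hzT, if_true]
        linarith
      · simp only [hz, hzT, if_true, if_false, zero_add]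
        exact prodExp_not_strictLeader_mask_le hη0 hη1 h hk hmin hTk hz (not_le.1 hzT)
    · simp only [hz, if_false]
      have : (0 : ℝ) ≤ if T ≤ deficit C z then 1 else 0 := by positivity
      linarith
  · rw [prodExp_add, prodExp_add, prodExp_const hw1]
    linarith

open Classical in
/-- Decoding to a nearest codeword succeeds when the error string is strictly lightest in its
coset. -/
theorem exists_decoder (C : Submodule F (Fin n → F)) {s : ℝ} (h0 : 0 ≤ s) (h1 : s ≤ 1) :
    ∃ D : RandomizedDecoder (C : Set (Fin n → F)), ∀ c,
      1 - prodExp (symbolWeight s) (fun z : Fin n → F => if IsStrictLeader C z then 0 else 1) ≤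
        successProb D s c := by
  have hnear : ∀ y : Fin n → F, ∃ c : C, ∀ c' : C,
      hammingDist y (c : Fin n → F) ≤ hammingDist y (c' : Fin n → F) := fun y =>
    Finite.exists_min fun c : C => hammingDist y (c : Fin n → F)
  choose d hd using hnear
  refine ⟨PMF.pure d, fun c => ?_⟩
  have hw1 := sum_symbolWeight (F := F) s
  have hsub := prodExp_sub (w := symbolWeight s) (fun _ : Fin n → F => 1)
    fun z => if IsStrictLeader C z then 0 else 1
  rw [prodExp_const hw1] at hsub
  rw [← hsub, successProb, sum_noiseProb_mul]
  refine prodExp_mono (symbolWeight_nonneg h0 h1) fun z => ?_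
  split_ifs with hz
  · have hdc : d (↑c + z) = c := by
      by_contra hne
      have h2 := hd (↑c + z) c
      rw [hammingDist_eq_norm_sub, hammingDist_eq_norm_sub, add_sub_cancel_left] at h2
      -- A wrong output `d` makes `d - c` a nonzero codeword with `z - (d - c)` no heavier than `z`.
      have h3 := hz (d (↑c + z) - c : Fin n → F) (C.sub_mem (d _).2 c.2)
        (sub_ne_zero.2 fun h => hne (Subtype.ext h))
      have : z - ((d (↑c + z) : Fin n → F) - c) = ↑c + z - d (↑c + z) := by abel
      rw [this] at h3
      omega
    have hone : (PMF.pure d).toOuterMeasure {d | d (↑c + z) = c} = 1 := by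
      rw [PMF.toOuterMeasure_pure_apply]
      exact if_pos hdc
    erw [hone]
    simp
  · simp

end Decoding

/-! ### Excluding noise levels above `1 - 1/q` -/

section LargeNoise

/-- The `q`-ary entropy equals `1` at `1 - 1/q` and decreases strictly beyond. Above that threshold
the limiting rate is thus positive. -/
theorem qEntropy_lt_one {q : ℕ} (hq : 2 ≤ q) {p : ℝ} (hp0 : 0 < p) (hp1 : p < 1)
    (hp : 1 - 1 / (q : ℝ) < p) : qEntropy q p < 1 := by
  have hq' : (2 : ℝ) ≤ q := by exact_mod_cast hq
  have hlog : 0 < Real.log q := Real.log_pos (by linarith)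
  have hinv : (0 : ℝ) < 1 / q := by positivity
  have hinv1 : (1 : ℝ) / q < 1 := by rw [div_lt_one] <;> linarith
  have hcast : (((q : ℤ) - 1 : ℤ) : ℝ) = (q : ℝ) - 1 := by push_cast; ring
  have hval : ∀ t : ℝ, 0 < t → t < 1 → qEntropy q t = Real.qaryEntropy q t / Real.log q := by
    intro t ht0 ht1
    rw [qEntropy, Real.qaryEntropy, Real.binEntropy, hcast, Real.logb, Real.logb,
      Real.log_div (by linarith) ht0.ne', one_div, Real.log_inv t]
    field_simp
    ring
  have hmax : Real.qaryEntropy q (1 - 1 / q) = Real.log q := by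
    have h1 : (1 - 1 / (q : ℝ))⁻¹ = q / (q - 1) := by
      have : (q : ℝ) - 1 ≠ 0 := by linarith
      field_simp
    rw [Real.qaryEntropy, Real.binEntropy, hcast, sub_sub_cancel, h1,
      Real.log_div (by linarith) (by linarith), one_div, inv_inv]
    ring
  rw [hval p hp0 hp1, div_lt_one hlog, ← hmax]
  exact Real.qaryEntropy_strictAntiOn hq ⟨le_rfl, by linarith⟩ ⟨hp.le, hp1.le⟩ hp

/-- A code that is list-decodable beyond radius `1 - 1 / q` has few codewords. -/
theorem IsListDecodable.ncard_le {F : Type*} [Field F] [Fintype F] [DecidableEq F] {n : ℕ}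
    {C : Set (Fin n → F)} {r : ℝ} {L : ℕ} (h : IsListDecodable C r L)
    (hr : 1 - 1 / (Fintype.card F : ℝ) < r)
    (hn : 2 ≤ n * (r - (1 - 1 / (Fintype.card F : ℝ))) ^ 2) : (C.ncard : ℝ) ≤ 2 * L := by
  classical
  have hq := one_lt_card_real F
  set s : ℝ := 1 - 1 / (Fintype.card F : ℝ) with hs
  have hinv : 1 / (Fintype.card F : ℝ) < 1 := by rw [div_lt_one] <;> linarith
  have hinv0 : 0 < 1 / (Fintype.card F : ℝ) := by positivity
  have h0 : 0 ≤ s := by linarith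
  have h1 : s ≤ 1 := by linarith
  have hn0 : 0 < n := by
    rcases Nat.eq_zero_or_pos n with rfl | h
    · norm_num at hn
    · exact h
  -- Noise of level `1 - 1/q` is uniform. A uniform centre is within `r n` of each codeword with
  -- probability at least `1/2`, so the mean list size is at least `|C| / 2`, yet at most `L`.
  have hunif : ∀ a : F, symbolWeight s a = 1 / (Fintype.card F : ℝ) := fun a => by
    unfold symbolWeight
    split_ifs
    · rw [hs]; ring
    · rw [hs]
      have : (Fintype.card F : ℝ) - 1 ≠ 0 := by linarith
      field_simp
  have hw := symbolWeight_nonneg (F := F) h0 h1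
  have hw1 := sum_symbolWeight (F := F) s
  have hlight : ∀ c : Fin n → F, 1 / 2 ≤ prodExp (symbolWeight s)
      (fun w => if (hammingDist w c : ℝ) ≤ r * n then 1 else 0) := by
    intro c
    have htrans : prodExp (symbolWeight s)
        (fun w => if (hammingDist w c : ℝ) ≤ r * n then 1 else 0) =
        prodExp (symbolWeight s)
          (fun z : Fin n → F => if (hammingNorm z : ℝ) ≤ r * n then 1 else 0) := by
      unfold prodExp
      simp only [hunif]
      exact Fintype.sum_equiv (Equiv.subRight c) _ _ fun w => by
        simp [hammingDist_eq_norm_sub]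
    have hcompl : (fun z : Fin n → F => if (hammingNorm z : ℝ) ≤ r * n then (1 : ℝ) else 0) =
        fun z => 1 - if (hammingNorm z : ℝ) ≤ r * n then 0 else 1 := by
      funext z; split_ifs <;> norm_num
    have hheavy := prodExp_heavy_le (F := F) h0 h1 hr hn0
    have : 1 / (n * (r - s) ^ 2) ≤ 1 / 2 := one_div_le_one_div_of_le (by norm_num) hn
    rw [htrans, hcompl, prodExp_sub, prodExp_const hw1]
    linarith
  have hcount : ∀ w : Fin n → F,
      ∑ c ∈ C.toFinset, (if (hammingDist w c : ℝ) ≤ r * n then (1 : ℝ) else 0) ≤ L := by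
    intro w
    rw [Finset.sum_boole]
    have := h w
    rw [Set.ncard_eq_toFinset_card'] at this
    refine le_trans (Nat.cast_le.2 (Finset.card_le_card fun c hc => ?_)) (Nat.cast_le.2 this)
    simpa using hc
  have hsum : ∑ c ∈ C.toFinset, (1 / 2 : ℝ) ≤ L := by
    calc ∑ c ∈ C.toFinset, (1 / 2 : ℝ) ≤ ∑ c ∈ C.toFinset, prodExp (symbolWeight s)
          (fun w => if (hammingDist w c : ℝ) ≤ r * n then 1 else 0) :=
          Finset.sum_le_sum fun c _ => hlight c
      _ ≤ prodExp (symbolWeight s) (fun _ : Fin n → F => (L : ℝ)) := by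
          rw [← prodExp_sum]
          exact prodExp_mono hw hcount
      _ = L := prodExp_const hw1 _
  rw [Finset.sum_const, nsmul_eq_mul, ← Set.ncard_eq_toFinset_card'] at hsum
  linarith

/-- For such `q` the code would have at most `2L` words, while its positive limiting rate makes it
exponentially large. Any subexponential list size gives the contradiction; `n + 1` is used. -/
theorem eventually_card_ne {F : ℕ → Type*} [∀ n, Field (F n)] [∀ n, Fintype (F n)]
    [∀ n, DecidableEq (F n)] {p : ℝ} (hp0 : 0 < p) (hp1 : p < 1) {C : ∀ n, Set (Fin n → F n)}
    (hC : AchievesListDecodingCapacity C p) {q : ℕ} (hq : 2 ≤ q) (hp : 1 - 1 / (q : ℝ) < p) :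
    ∀ᶠ n in atTop, Fintype.card (F n) ≠ q := by
  have hq' : (1 : ℝ) < q := by exact_mod_cast hq
  have hlogq : 0 < Real.log q := Real.log_pos hq'
  obtain ⟨hrate, hlist⟩ := hC
  obtain ⟨ε, hε, hLD⟩ := hlist (fun n => n + 1) (fun n => by omega) (tendsto_add_atTop_nat 1)
  set γ := (p - (1 - 1 / (q : ℝ))) / 2 with hγ
  have hγ0 : 0 < γ := by rw [hγ]; linarith
  set θ := (1 - qEntropy q p) / 2 with hθ
  have hθ0 : 0 < θ := by rw [hθ]; linarith [qEntropy_lt_one hq hp0 hp1 hp]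
  have hlarge : Tendsto (fun n : ℕ => (n : ℝ) * γ ^ 2) atTop atTop :=
    tendsto_natCast_atTop_atTop.atTop_mul_const (by positivity)
  have hlog : ∀ᶠ n : ℕ in atTop, Real.log (4 * n) < θ * Real.log q * n := by
    have h4 : Tendsto (fun n : ℕ => (4 : ℝ) * n) atTop atTop :=
      tendsto_natCast_atTop_atTop.const_mul_atTop (by norm_num)
    have hc : 0 < θ * Real.log q / 8 := by positivity
    filter_upwards [(Real.isLittleO_log_id_atTop.comp_tendsto h4).bound hc,
      eventually_gt_atTop 0] with n hn hn0
    have hn0' : (0 : ℝ) < n := by exact_mod_cast hn0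
    simp only [Function.comp, id, Real.norm_eq_abs] at hn
    rw [abs_of_pos (by positivity : (0 : ℝ) < 4 * n)] at hn
    have := (le_abs_self _).trans hn
    have hpos : 0 < θ * Real.log q * n := by positivity
    linarith
  filter_upwards [hrate.eventually (lt_mem_nhds (neg_lt_zero.2 hθ0)),
    hε.eventually (gt_mem_nhds hγ0), hlarge.eventually_ge_atTop 2, hlog, eventually_gt_atTop 0]
    with n hn1 hn2 hn3 hn4 hn5 hcard
  have hn5' : (1 : ℝ) ≤ n := by exact_mod_cast hn5
  have hgap : γ ≤ p - ε n - (1 - 1 / (Fintype.card (F n) : ℝ)) := by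
    rw [hcard]; linarith
  have hsmall := (hLD n).ncard_le (by linarith)
    (hn3.trans (by gcongr))
  rw [hcard, rate, hcard] at hn1
  have hlogb : θ * n < Real.logb q ((C n).ncard : ℝ) := by
    rw [← lt_div_iff₀ (by linarith)]
    linarith
  rw [Real.logb, lt_div_iff₀ hlogq] at hlogb
  have hpos : (0 : ℝ) < (C n).ncard := by
    rcases Nat.eq_zero_or_pos (C n).ncard with h | h
    · rw [h, Nat.cast_zero, Real.log_zero] at hlogb
      have : 0 < θ * n * Real.log q := by positivity
      linarith
    · exact_mod_cast h
  have : Real.log ((C n).ncard : ℝ) ≤ Real.log (4 * n) := by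
    refine Real.log_le_log hpos (hsmall.trans ?_)
    push_cast
    linarith
  nlinarith

/-- List-decoding capacity forces the noise level to be at most `1 - 1 / q`. -/
theorem AchievesListDecodingCapacity.eventually_le {F : ℕ → Type*} [∀ n, Field (F n)]
    [∀ n, Fintype (F n)] [∀ n, DecidableEq (F n)] {p : ℝ} (hp0 : 0 < p) (hp1 : p < 1)
    {C : ∀ n, Set (Fin n → F n)} (hC : AchievesListDecodingCapacity C p) :
    ∀ᶠ n in atTop, p ≤ 1 - 1 / (Fintype.card (F n) : ℝ) := by
  -- A violation means `q < 1 / (1 - p)`, so only finitely many field sizes need excluding, even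
  -- though `q` varies with `n`.
  obtain ⟨N, hN⟩ := exists_nat_gt (1 / (1 - p))
  have hall : ∀ᶠ n in atTop, ∀ q ∈ Finset.range N, 2 ≤ q → 1 - 1 / (q : ℝ) < p →
      Fintype.card (F n) ≠ q := by
    rw [Filter.eventually_all_finset]
    intro q _
    by_cases hq : 2 ≤ q ∧ 1 - 1 / (q : ℝ) < p
    · filter_upwards [eventually_card_ne hp0 hp1 hC hq.1 hq.2] with n hn _ _ using hn
    · exact Eventually.of_forall fun n h1 h2 => absurd ⟨h1, h2⟩ hq
  filter_upwards [hall] with n hn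
  by_contra hlt
  push Not at hlt
  have hq := one_lt_card_real (F n)
  refine hn (Fintype.card (F n)) (Finset.mem_range.2 ?_) Fintype.one_lt_card hlt rfl
  have : (Fintype.card (F n) : ℝ) < 1 / (1 - p) := by
    rw [lt_div_iff₀ (by linarith)]
    have h2 : 1 - p < 1 / (Fintype.card (F n) : ℝ) := by linarith
    rw [lt_div_iff₀ (by linarith)] at h2
    linarith
  exact_mod_cast this.trans hN

end LargeNoise

/-! ### Choice of parameters and passage to the limit -/

section Limit

/-- Diagonalization: use `p / (j + 1)` for the largest `j ≤ n` that works at `n`. The choice `j = 0`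
always works by `htriv`. -/
theorem exists_tendsto_zero_of_eventually {P : ℕ → ℝ → Prop} {p : ℝ} (hp : 0 < p)
    (htriv : ∀ n, P n p) (h : ∀ ε, 0 < ε → ε < p → ∀ᶠ n in atTop, P n ε) :
    ∃ ε : ℕ → ℝ, Tendsto ε atTop (𝓝 0) ∧ (∀ n, 0 ≤ ε n ∧ ε n ≤ p) ∧ ∀ n, P n (ε n) := by
  classical
  set J : ℕ → ℕ := fun n => Nat.findGreatest (fun j => P n (p / (j + 1))) n with hJ
  have hJtop : Tendsto J atTop atTop := by
    refine tendsto_atTop.2 fun B => ?_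
    have hB : ∀ᶠ n in atTop, P n (p / (B + 1)) := by
      rcases Nat.eq_zero_or_pos B with rfl | hB
      · exact Eventually.of_forall fun n => by simpa using htriv n
      · have hB' : (0 : ℝ) < B := by exact_mod_cast hB
        refine h _ (by positivity) ?_
        rw [div_lt_iff₀ (by positivity)]
        nlinarith
    filter_upwards [hB, eventually_ge_atTop B] with n hn hBn
    exact Nat.le_findGreatest hBn hn
  refine ⟨fun n => p / (J n + 1), ?_, fun n => ⟨by positivity, ?_⟩, fun n => ?_⟩
  · exact tendsto_const_nhds.div_atTop
      (tendsto_atTop_add_const_right _ _ (tendsto_natCast_atTop_atTop.comp hJtop))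
  · exact div_le_self hp.le (by linarith [(Nat.cast_nonneg (J n) : (0 : ℝ) ≤ J n)])
  · exact Nat.findGreatest_spec (P := fun j => P n (p / (j + 1))) (Nat.zero_le n)
      (by simpa using htriv n)

theorem minDist_le_hammingNorm {F : Type*} [Field F] [DecidableEq F] {n : ℕ}
    (C : Submodule F (Fin n → F)) {c : Fin n → F} (hc : c ∈ C) (hc0 : c ≠ 0) :
    minDist (C : Set (Fin n → F)) ≤ hammingNorm c := by
  refine (iInf₂_le c hc).trans ((iInf₂_le 0 C.zero_mem).trans ((iInf_le _ hc0).trans ?_))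
  rw [hammingDist_zero_right]

/-- Noise of level `0` is decoded correctly. -/
theorem exists_decoder_zero {F : Type*} [Field F] [Fintype F] [DecidableEq F] {n : ℕ}
    (C : Submodule F (Fin n → F)) :
    ∃ D : RandomizedDecoder (C : Set (Fin n → F)), ∀ c, 1 ≤ successProb D 0 c := by
  classical
  obtain ⟨D, hD⟩ := exists_decoder C le_rfl zero_le_one
  refine ⟨D, fun c => le_trans (le_of_eq ?_) (hD c)⟩
  have hzero : prodExp (symbolWeight 0)
      (fun z : Fin n → F => if IsStrictLeader C z then 0 else 1) = 0 := by
    rw [← sum_noiseProb_mul]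
    refine Finset.sum_eq_zero fun z _ => ?_
    by_cases hz : z = 0
    · subst hz
      have : IsStrictLeader C (0 : Fin n → F) := fun c _ hc0 => by
        rw [zero_sub, hammingNorm_zero]
        exact hammingNorm_pos_iff.2 (neg_ne_zero.2 hc0)
      simp [this]
    · have : hammingNorm z ≠ 0 := hammingNorm_ne_zero_iff.2 hz
      rw [noiseProb_eq_pow]
      simp [this]
  rw [hzero, sub_zero]

variable {F : ℕ → Type*} [∀ n, Field (F n)] [∀ n, DecidableEq (F n)]

/-- A slowly growing list size `L` with `L ^ 4` bounded by the minimum distance. -/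
theorem exists_listSize (C : ∀ n, Submodule (F n) (Fin n → F n))
    (hd : ∀ B : ℕ, ∀ᶠ n in atTop, (B : ℕ∞) ≤ minDist (C n : Set (Fin n → F n))) :
    ∃ L : ℕ → ℕ, (∀ n, 1 ≤ L n) ∧ Tendsto L atTop atTop ∧
      ∀ᶠ n in atTop, ∀ c ∈ C n, c ≠ 0 → L n ^ 4 ≤ hammingNorm c := by
  classical
  set J : ℕ → ℕ := fun n =>
    Nat.findGreatest (fun j => ((j ^ 4 : ℕ) : ℕ∞) ≤ minDist (C n : Set (Fin n → F n))) n with hJ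
  have hJtop : Tendsto J atTop atTop := by
    refine tendsto_atTop.2 fun B => ?_
    filter_upwards [hd (B ^ 4), eventually_ge_atTop B] with n hn hBn
    exact Nat.le_findGreatest hBn hn
  refine ⟨fun n => max 1 (J n), fun n => le_max_left _ _,
    tendsto_atTop_mono (fun n => le_max_right _ _) hJtop, ?_⟩
  filter_upwards [hJtop.eventually_ge_atTop 1] with n hn c hc hc0
  rw [max_eq_right hn]
  have h1 : ((J n ^ 4 : ℕ) : ℕ∞) ≤ minDist (C n : Set (Fin n → F n)) :=
    Nat.findGreatest_spec
      (P := fun j => ((j ^ 4 : ℕ) : ℕ∞) ≤ minDist (C n : Set (Fin n → F n))) (Nat.zero_le n)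
      (by simp)
  exact_mod_cast h1.trans (minDist_le_hammingNorm (C n) hc hc0)

/-- The slack `ε` is split: list decoding reaches radius `p - ε/4`, the first-stage noise `p - ε/2`
stays inside it with high probability, and erasures lower the level to `p - ε`. -/
theorem eventually_exists_decoder [∀ n, Fintype (F n)] {p : ℝ} (hp0 : 0 < p) (hp1 : p < 1)
    (C : ∀ n, Submodule (F n) (Fin n → F n))
    (hlist : AchievesListDecodingCapacity (fun n => (C n : Set (Fin n → F n))) p)
    (hd : ∀ B : ℕ, ∀ᶠ n in atTop, (B : ℕ∞) ≤ minDist (C n : Set (Fin n → F n)))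
    {ε : ℝ} (hε0 : 0 < ε) (hεp : ε < p) :
    ∀ᶠ n in atTop, ∃ D : RandomizedDecoder (C n : Set (Fin n → F n)),
      ∀ c, 1 - ε ≤ successProb D (p - ε) c := by
  classical
  obtain ⟨L, hL1, hLtop, hLd⟩ := exists_listSize C hd
  obtain ⟨δ, hδ, hLD⟩ := hlist.2 L hL1 hLtop
  have hs0 : 0 < p - ε / 2 := by linarith
  set η : ℝ := (ε / 2) / (p - ε / 2) with hη
  have hη0 : 0 < η := by positivity
  have hη1 : η ≤ 1 := by rw [hη, div_le_one hs0]; linarith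
  have hnoise : (p - ε / 2) * (1 - η) = p - ε := by
    rw [hη, mul_sub, mul_div_cancel₀ _ hs0.ne']; ring
  have hLR : Tendsto (fun n => (L n : ℝ)) atTop atTop := tendsto_natCast_atTop_atTop.comp hLtop
  have hρ : Tendsto (fun n : ℕ => 1 / ((n : ℝ) * (ε / 4) ^ 2)) atTop (𝓝 0) :=
    tendsto_const_nhds.div_atTop
      (tendsto_natCast_atTop_atTop.atTop_mul_const (by positivity))
  have hinv : Tendsto (fun n => (1 + 8 / η) / (L n : ℝ)) atTop (𝓝 0) :=
    tendsto_const_nhds.div_atTop hLR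
  filter_upwards [hLd, AchievesListDecodingCapacity.eventually_le hp0 hp1 hlist,
    hδ.eventually (gt_mem_nhds (by positivity : 0 < ε / 4)),
    hLR.eventually_ge_atTop (16 / η), hρ.eventually (gt_mem_nhds (by norm_num : (0 : ℝ) < 1 / 2)),
    hρ.eventually (gt_mem_nhds (by positivity : 0 < ε / 2)),
    hinv.eventually (gt_mem_nhds (by positivity : 0 < ε / 2)), eventually_gt_atTop 0]
    with n hmin hpq hδn hLη hρ2 hρε hLε hn0
  have hL1' : (1 : ℝ) ≤ L n := by exact_mod_cast hL1 n
  have hheavy := prodExp_heavy_le (F := F n) (n := n) (s := p - ε / 2) (r := p - ε / 4) hs0.le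
    (by linarith) (by linarith) hn0
  rw [show p - ε / 4 - (p - ε / 2) = ε / 4 by ring] at hheavy
  -- With `T = 4L` and `k = L^4`, the loss `12L / T²` is `O(1/L)`, and `4T ≤ η√k` amounts to `L ≥
  -- 16/η`.
  have hfail := prodExp_not_strictLeader_le (C := C n) (s := p - ε / 2) (η := η) (r := p - ε / 4)
    (k := (L n : ℝ) ^ 4) (T := 4 * L n) hs0.le (by linarith) (by linarith) hη0 hη1 (hL1 n)
    ((hLD n).mono (by linarith)) (by positivity)
    (fun c hc hc0 => by exact_mod_cast hmin c hc hc0) (by positivity) (by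
      rw [show (L n : ℝ) ^ 4 = (L n ^ 2 : ℝ) ^ 2 by ring, Real.sqrt_sq (by positivity)]
      rw [div_le_iff₀ hη0] at hLη
      nlinarith) hheavy hρ2.le
  rw [hnoise] at hfail
  obtain ⟨D, hD⟩ := exists_decoder (C n) (s := p - ε) (by linarith) (by linarith)
  refine ⟨D, fun c => le_trans ?_ (hD c)⟩
  have h1 : 12 * (L n : ℝ) / (4 * L n) ^ 2 ≤ 1 / L n := by
    rw [div_le_div_iff₀ (by positivity) (by positivity)]
    nlinarith
  have h2 : (L n : ℝ) * (8 / (η * (L n : ℝ) ^ 4)) ≤ 8 / η / L n := by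
    rw [div_div, mul_div_assoc', div_le_div_iff₀ (by positivity) (by positivity)]
    have h3 : (L n : ℝ) ^ 2 ≤ L n ^ 4 := pow_le_pow_right₀ hL1' (by norm_num)
    nlinarith [mul_le_mul_of_nonneg_left h3 hη0.le]
  rw [add_div] at hLε
  linarith

end Limit

end CapacityBridge

theorem theorem1 {F : ℕ → Type*} [∀ n, Field (F n)] [∀ n, Fintype (F n)]
    [∀ n, DecidableEq (F n)] (p : ℝ) (hp0 : 0 < p) (hp1 : p < 1)
    (C : ∀ n, Submodule (F n) (Fin n → F n))
    (hlist : CapacityBridge.AchievesListDecodingCapacity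
      (fun n => (C n : Set (Fin n → F n))) p)
    (hdist : Tendsto
      (fun n => (CapacityBridge.minDist (C n : Set (Fin n → F n)) : ℝ≥0∞) /
        ENNReal.ofReal ((Fintype.card (F n) : ℝ) ^ 3 / (1 - p) ^ 2))
      atTop (𝓝 ∞)) :
    CapacityBridge.AchievesQSCCapacity (fun n => (C n : Set (Fin n → F n))) p := by
  have hd : ∀ B : ℕ, ∀ᶠ n in atTop,
      (B : ℕ∞) ≤ CapacityBridge.minDist (C n : Set (Fin n → F n)) := by
    intro B
    filter_upwards [ENNReal.tendsto_nhds_top_iff_nat.1 hdist B] with n hn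
    -- The normalizer is at least `1`, so the minimum distance itself tends to infinity.
    have hone : 1 ≤ ENNReal.ofReal ((Fintype.card (F n) : ℝ) ^ 3 / (1 - p) ^ 2) := by
      rw [ENNReal.one_le_ofReal, one_le_div (by nlinarith)]
      have h1 : (1 - p) ^ 2 ≤ 1 := by nlinarith
      exact h1.trans (one_le_pow₀ (CapacityBridge.one_lt_card_real (F n)).le)
    have hle := hn.le.trans (ENNReal.div_le_of_le_mul (le_mul_of_one_le_right' hone))
    exact_mod_cast hle
  obtain ⟨ε, hε, hεp, hD⟩ := CapacityBridge.exists_tendsto_zero_of_eventually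
    (P := fun n ε => ∃ D : CapacityBridge.RandomizedDecoder (C n : Set (Fin n → F n)),
      ∀ c, 1 - ε ≤ CapacityBridge.successProb D (p - ε) c) hp0
    (fun n => by
      obtain ⟨D, hD⟩ := CapacityBridge.exists_decoder_zero (C n)
      refine ⟨D, fun c => ?_⟩
      rw [sub_self]
      linarith [hD c])
    (fun ε hε0 hε1 => CapacityBridge.eventually_exists_decoder hp0 hp1 C hlist hd hε0 hε1)
  exact ⟨hlist.1, ε, hε, hεp, hD⟩
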